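/- Let $\nu$ be a Borel probability measure on $\mathbb{R}$ with compact topological support, let $\Omega=(\operatorname{supp}\nu)^{\mathbb{Z}}$ with the product measure $\mu=\nu^{\mathbb{Z}}$, and for $\omega\in\Omega$ let $H_\omega$ be the bounded self-adjoint operator on $\ell^2(\mathbb{Z})$ given by $$[H_\omega\psi](n)=\psi(n+1)+\psi(n-1)+\omega_n\,\psi(n).$$ With $\delta_n$ the standard unit vectors of $\ell^2(\mathbb{Z})$, put $$a(m,n)=\int_\Omega\Big(\sup_{t\in\mathbb{R}}\big|\langle\delta_m,e^{-itH_\omega}\delta_n\rangle\big|\Big)\,d\mu(\omega),\qquad m,n\in\mathbb{Z}.$$ Suppose that there are constants $C,\gamma\in(0,\infty)$ such that $$\max_{n\in\{0,1\}}a(m,n)\le C e^{-\gamma|m|}\qquad\text{for all } m\in\mathbb{Z}.$$ Then for $\mu$-almost every $\omega\in\Omega$ the following hold. (i) $H_\omega$ has pure point spectrum: there are $E_k\in\mathbb{R}$ and non-zero $\psi_k\in\ell^2(\mathbb{Z})$ ($k = 0, 1, 2, \ldots$) with $H_\omega\psi_k=E_k\psi_k$ such that the finite linear combinations of the $\psi_k$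 are dense in $\ell^2(\mathbb{Z})$. (ii) For every $\varepsilon>0$ and every eigenvector $u\in\ell^2(\mathbb{Z})$ of $H_\omega$ there is a constant $C_{\omega,\varepsilon,u}\in(0,\infty)$ such that $$|u(n)|\le C_{\omega,\varepsilon,u}\,e^{-(\gamma-\varepsilon)|n|}\qquad\text{for all } n\in\mathbb{Z}.$$ -/

import Mathlib

open MeasureTheory
open scoped ENNReal lp

noncomputable section

namespace RandomSchrodinger

/-- The Hilbert space `ℓ²(ℤ)` of complex-valued square-summable sequences. -/
abbrev HilbertZ : Type := ℓ²(ℤ, ℂ)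

/-- The shift by `k` on `ℓ²(ℤ)`: `(shift k ψ)(n) = ψ(n + k)`. -/
def shift (k : ℤ) : HilbertZ →L[ℂ] HilbertZ :=
  LinearMap.mkContinuous
    { toFun := fun ψ => ⟨fun n => ψ (n + k), by
        refine memℓp_gen ?_
        exact (Equiv.addRight k).summable_iff.mpr ((lp.memℓp ψ).summable (by norm_num))⟩
      map_add' := fun _ _ => by ext; rfl
      map_smul' := fun _ _ => by ext; simp }
    1
    (fun ψ => by
      have h2 : 0 < (2 : ℝ≥0∞).toReal := by norm_num
      refine lp.norm_le_of_tsum_le h2 (by positivity) ?_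
      rw [one_mul, lp.norm_rpow_eq_tsum h2]
      exact le_of_eq ((Equiv.addRight k).tsum_eq (fun n => ‖ψ n‖ ^ (2 : ℝ≥0∞).toReal)))

/-- Multiplication by a bounded real-valued sequence `V`, on `ℓ²(ℤ)`. -/
def mulOp (V : ℓ^∞(ℤ, ℝ)) : HilbertZ →L[ℂ] HilbertZ :=
  lp.mapCLM 2 (fun n => (V n : ℂ) • ContinuousLinearMap.id ℂ ℂ) (norm_nonneg V)
    (fun n => by
      have h := lp.norm_apply_le_norm ENNReal.top_ne_zero V n
      simpa [norm_smul] using h)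

/-- The discrete Schrödinger operator
`[H ψ](n) = ψ(n + 1) + ψ(n - 1) + V(n) ψ(n)` on `ℓ²(ℤ)` with bounded real potential `V`. -/
def schrodingerOp (V : ℓ^∞(ℤ, ℝ)) : HilbertZ →L[ℂ] HilbertZ :=
  shift 1 + shift (-1) + mulOp V

theorem schrodingerOp_apply (V : ℓ^∞(ℤ, ℝ)) (ψ : HilbertZ) (n : ℤ) :
    schrodingerOp V ψ n = ψ (n + 1) + ψ (n - 1) + (V n : ℂ) * ψ n := by
  rfl

/-- The standard unit vector `δ_n` of `ℓ²(ℤ)`. -/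
def delta (n : ℤ) : HilbertZ := lp.single 2 n (1 : ℂ)

/-- The unitary group `e^{-itA}` generated by a bounded operator `A`. -/
def propagator (A : HilbertZ →L[ℂ] HilbertZ) (t : ℝ) : HilbertZ →L[ℂ] HilbertZ :=
  NormedSpace.exp ((-(Complex.I * (t : ℂ))) • A)

/-- A bounded operator `A` on `ℓ²(ℤ)` has pure point spectrum: there are real numbers `E k` and
(non-zero) eigenvectors `ψ k` with `A (ψ k) = E k • ψ k` whose finite linear combinations are dense
in `ℓ²(ℤ)`. -/
def HasPurePointSpectrum (A : HilbertZ →L[ℂ] HilbertZ) : Prop :=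
  ∃ (E : ℕ → ℝ) (ψ : ℕ → HilbertZ),
    (∀ k, ψ k ≠ 0 ∧ A (ψ k) = (E k : ℂ) • ψ k) ∧
    Dense (Submodule.span ℂ (Set.range ψ) : Set HilbertZ)

/-- The sample space `Ω = (supp ν)^ℤ`, with the product `σ`-algebra. -/
abbrev Sample (ν : Measure ℝ) : Type := ℤ → ν.support

/-- The single-site distribution `ν`, seen as a measure on its own topological support. -/
def siteMeasure (ν : Measure ℝ) : Measure ν.support := ν.comap Subtype.val

instance (ν : Measure ℝ) [IsProbabilityMeasure ν] : IsProbabilityMeasure (siteMeasure ν) :=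
  (MeasurableEmbedding.subtype_coe
    Measure.isClosed_support.measurableSet).isProbabilityMeasure_comap (by
      rw [Subtype.range_coe]
      exact Measure.support_mem_ae)

/-- The product measure `μ = ν^ℤ` on `Ω = (supp ν)^ℤ`. -/
def sampleMeasure (ν : Measure ℝ) : Measure (Sample ν) :=
  Measure.infinitePi (fun _ : ℤ => siteMeasure ν)

instance (ν : Measure ℝ) [IsProbabilityMeasure ν] : IsProbabilityMeasure (sampleMeasure ν) :=
  inferInstanceAs (IsProbabilityMeasure (Measure.infinitePi (fun _ : ℤ => siteMeasure ν)))

/-- The random potential `V_ω(n) = ω_n`, bounded since `supp ν` is compact. -/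
def potential {ν : Measure ℝ} (hν : IsCompact ν.support) (ω : Sample ν) : ℓ^∞(ℤ, ℝ) :=
  ⟨fun n => (ω n : ℝ), memℓp_infty (by
    obtain ⟨K, hK⟩ := hν.isBounded.exists_norm_le
    exact ⟨K, by rintro _ ⟨n, rfl⟩; exact hK _ (ω n).2⟩)⟩

/-- The random operator `H_ω`. -/
def randomOp {ν : Measure ℝ} (hν : IsCompact ν.support) (ω : Sample ν) :
    HilbertZ →L[ℂ] HilbertZ :=
  schrodingerOp (potential hν ω)

/-- `a(m, n) = ∫_Ω sup_{t ∈ ℝ} |⟨δ_m, e^{-itH_ω} δ_n⟩| dμ(ω)`, as an element of `[0, ∞]`. -/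
def dynAmplitude {ν : Measure ℝ} (hν : IsCompact ν.support) (m n : ℤ) : ℝ≥0∞ :=
  ∫⁻ ω, ⨆ t : ℝ, ‖inner ℂ (delta m) (propagator (randomOp hν ω) t (delta n))‖ₑ ∂(sampleMeasure ν)

end RandomSchrodinger

end

/-! The hypothesis yields, almost surely, a summable `b` with exponential decay that dominates the
orbits of `δ₀` and `δ₁` for all times: the weighted sum over `m` of the suprema has finite
expectation, so it is finite almost everywhere. The rest is deterministic and rests on averaging
flows over compact convex sets (`exists_mem_apply_eq_zero_of_flow`).

Pure point spectrum: let `N` be the orthogonal complement of all eigenvectors. If `δ₀` or `δ₁` had a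
nonzero component in `N`, the orbit of that component would be precompact, since a box dominated by
a summable sequence is compact in `ℓ²`. Averaging the rank-one operators along the orbit gives a
nonzero compact self-adjoint operator that commutes with `H` and has range in `N`. Its eigenspaces
then contain eigenvectors of `H` inside `N`, a contradiction. So `δ₀, δ₁ ∈ Nᗮ`, and the three-term
recurrence generates every `δ_n` from these two.

Decay: averaging `e^{i(E-H)t}δ_j` gives the projection `φ_j` of `δ_j` to the eigenspace of `E`,
still dominated by `b`. An eigenvector orthogonal to `φ₀` and `φ₁` vanishes at `0` and `1`, hence
everywhere, so `φ₀` and `φ₁` span the eigenspace. -/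

namespace RandomSchrodinger

open Filter Topology InnerProductSpace

/-! ### Time averages of linear flows -/

section Flow

variable {V : Type*} [NormedAddCommGroup V] [NormedSpace ℂ V] [CompleteSpace V]

/-- A bounded linear flow that stays in a compact convex set has a stationary point there, namely
a limit of its time averages. -/
theorem exists_mem_apply_eq_zero_of_flow (L : V →L[ℂ] V) (G : ℝ → V)
    (hG : ∀ t, HasDerivAt G (L (G t)) t) {K : Set V} (hK : IsCompact K) (hKc : Convex ℝ K)
    (hGK : ∀ t, G t ∈ K) : ∃ Q ∈ K, L Q = 0 := by
  have hcont : Continuous G := continuous_iff_continuousAt.2 fun t => (hG t).continuousAt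
  have hpos : ∀ n : ℕ, (0 : ℝ) < n + 1 := fun n => by positivity
  let A : ℕ → V := fun n => ⨍ t in Set.Ioc (0 : ℝ) (n + 1), G t
  have hA : ∀ n, A n ∈ K := fun n => by
    refine hKc.set_average_mem hK.isClosed ?_ ?_ (Eventually.of_forall hGK) ?_
    · simpa using hpos n
    · simp
    · exact (hcont.integrableOn_Icc).mono_set Set.Ioc_subset_Icc_self
  -- The average of `G' = L G` telescopes to a boundary term over the length of the interval, which
  -- tends to `0` because `K` is bounded.
  have hLA : ∀ n, L (A n) = ((n : ℝ) + 1)⁻¹ • (G (n + 1) - G 0) := fun n => by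
    have h1 : A n = ((n : ℝ) + 1)⁻¹ • ∫ t in (0 : ℝ)..(n + 1), G t := by
      rw [intervalIntegral.integral_of_le (hpos n).le]
      simp only [A, setAverage_eq]
      congr 2
      simp [Measure.real, (hpos n).le]
    have h2 : ∫ t in (0 : ℝ)..(n + 1), L (G t) = G (n + 1) - G 0 :=
      intervalIntegral.integral_eq_sub_of_hasDerivAt (fun t _ => hG t)
        ((L.continuous.comp hcont).intervalIntegrable _ _)
    rw [h1, ← h2, L.intervalIntegral_comp_comm (hcont.intervalIntegrable _ _)]
    exact (L.restrictScalars ℝ).map_smul _ _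
  obtain ⟨Q, hQ, φ, hφ, hlim⟩ := hK.tendsto_subseq hA
  refine ⟨Q, hQ, ?_⟩
  have h0 : Tendsto (fun n : ℕ => L (A n)) atTop (𝓝 0) := by
    obtain ⟨B, hB⟩ := hK.isBounded.exists_norm_le
    refine squeeze_zero_norm (a := fun n : ℕ => ((n : ℝ) + 1)⁻¹ * (B + B)) (fun n => ?_) ?_
    · rw [hLA, norm_smul, Real.norm_of_nonneg (inv_nonneg.2 (hpos n).le)]
      exact mul_le_mul_of_nonneg_left ((norm_sub_le _ _).trans
        (add_le_add (hB _ (hGK _)) (hB _ (hGK _)))) (inv_nonneg.2 (hpos n).le)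
    · have := (tendsto_one_div_add_atTop_nhds_zero_nat (𝕜 := ℝ)).mul_const (B + B)
      simpa using this
  exact tendsto_nhds_unique ((L.continuous.tendsto Q).comp hlim) (h0.comp hφ.tendsto_atTop)

end Flow

/-! ### Eigenvectors from precompact orbits -/

section Hilbert

variable {F : Type*} [NormedAddCommGroup F] [InnerProductSpace ℂ F] [CompleteSpace F]

/-- Only real scalars work, as `rankOne` is conjugate-linear in its second argument. This suffices
to differentiate `rankOne (f t) (f t)` in real time. -/
theorem isBoundedBilinearMap_rankOne :
    IsBoundedBilinearMap ℝ fun p : F × F => rankOne ℂ p.1 p.2 where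
  add_left x₁ x₂ y := by rw [map_add, add_apply]
  smul_left c x y := by ext z; simp
  add_right x y₁ y₂ := (rankOne ℂ x).map_add y₁ y₂
  smul_right c x y := by
    ext z
    rw [smul_apply, rankOne_apply, rankOne_apply, ← Complex.coe_smul, inner_smul_left,
      Complex.conj_ofReal, mul_smul, Complex.coe_smul]
  bound := ⟨1, one_pos, fun x y => by simp⟩

/-- A nonzero trajectory of `f' = -iHf` with precompact range forces an eigenvector of `H`, which
can be found in any closed subspace containing the trajectory. -/
theorem exists_eigenvector_of_compact_orbit (H : F →L[ℂ] F) (hH : H.IsSymmetric) (f : ℝ → F)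
    (hf : ∀ t, HasDerivAt f (-(Complex.I • H (f t))) t) {X : Set F} (hX : IsCompact X)
    (hfX : ∀ t, f t ∈ X) (h0 : f 0 ≠ 0) (N : Submodule ℂ F) (hN : IsClosed (N : Set F))
    (hfN : ∀ t, f t ∈ N) : ∃ v ∈ N, v ≠ 0 ∧ ∃ z : ℂ, H v = z • v := by
  have hHs : ∀ x y, inner ℂ (H x) y = inner ℂ x (H y) := hH
  -- the norm is conserved
  have hconst : ∀ t, inner ℂ (f t) (f t) = inner ℂ (f 0) (f 0) := fun t => by
    refine is_const_of_deriv_eq_zero (f := fun t => inner ℂ (f t) (f t))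
      (fun t => ((hf t).inner ℂ (hf t)).differentiableAt) (fun t => ?_) t 0
    rw [((hf t).inner ℂ (hf t)).deriv]
    simp [inner_neg_left, inner_neg_right, inner_smul_left, inner_smul_right, hHs]
  have hnorm : ∀ t, ‖f t‖ = ‖f 0‖ := fun t => by
    have := hconst t
    rw [inner_self_eq_norm_sq_to_K, inner_self_eq_norm_sq_to_K] at this
    have h2 : ‖f t‖ ^ 2 = ‖f 0‖ ^ 2 := by exact_mod_cast this
    exact (pow_left_inj₀ (norm_nonneg _) (norm_nonneg _) two_ne_zero).1 h2
  set r := ‖f 0‖ with hr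
  have hrpos : 0 < r := norm_pos_iff.2 h0
  let Y : Set F := {g | g ∈ X ∧ ‖g‖ = r ∧ g ∈ N}
  have hY : IsCompact Y := by
    refine hX.inter_right ((isClosed_eq continuous_norm continuous_const).inter hN)
  let R : F → (F →L[ℂ] F) := fun g => rankOne ℂ g g
  have hRcont : Continuous R :=
    isBoundedBilinearMap_rankOne.continuous.comp (continuous_id.prodMk continuous_id)
  let K : Set (F →L[ℂ] F) := closure (convexHull ℝ (R '' Y))
  have hK : IsCompact K :=
    isCompact_closure_of_totallyBounded_quasiComplete (𝕜 := ℝ)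
      (hY.image hRcont).totallyBounded.convexHull
  have hKc : Convex ℝ K := (convex_convexHull ℝ _).closure
  -- Every closed convex property of the rank-one operators `R g` passes to all of `K`, hence to the
  -- averaged operator `Q`.
  have hKmin : ∀ Z : Set (F →L[ℂ] F), Convex ℝ Z → IsClosed Z → (∀ g ∈ Y, R g ∈ Z) → K ⊆ Z :=
    fun Z hZ hZc h => closure_minimal (convexHull_min (by rintro _ ⟨g, hg, rfl⟩; exact h g hg) hZ)
      hZc
  -- This is `T ↦ -i[H, T]`: along the orbit `R (f t)` solves the von Neumann equation, and
  -- stationary points commute with `H`.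
  let L : (F →L[ℂ] F) →L[ℂ] (F →L[ℂ] F) :=
    -(Complex.I • (ContinuousLinearMap.mul ℂ (F →L[ℂ] F) H
      - (ContinuousLinearMap.mul ℂ (F →L[ℂ] F)).flip H))
  obtain ⟨Q, hQK, hLQ⟩ := exists_mem_apply_eq_zero_of_flow L (fun t => R (f t)) (fun t => by
    have h1 := (isBoundedBilinearMap_rankOne (F := F)).hasFDerivAt (f t, f t)
    have h2 := h1.comp_hasDerivAt t ((hf t).prodMk (hf t))
    refine h2.congr_deriv ?_
    ext x
    simp [L, R, hHs, smul_smul]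
    module) hK hKc
    (fun t => subset_closure (subset_convexHull ℝ _ ⟨f t, ⟨hfX t, hnorm t, hfN t⟩, rfl⟩))
  have hcomm : ∀ x, H (Q x) = Q (H x) := fun x => by
    have : H * Q - Q * H = 0 := by simpa [L] using hLQ
    simpa [sub_eq_zero] using congrArg (fun T : F →L[ℂ] F => T x) this
  have hQcomp : IsCompactOperator Q := by
    have hsub := hKmin {T | IsCompactOperator T} ?_ isClosed_setOfPred_isCompactOperator ?_
    · exact hsub hQK
    · exact ((compactOperator (RingHom.id ℂ) F F).restrictScalars ℝ).convex
    · intro g _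
      exact (isCompactOperator_of_locallyCompactSpace_rng
        (ContinuousLinearMap.toSpanSingleton ℂ g)).comp_clm (innerSL ℂ g)
  have hQsymm : Q.IsSymmetric := by
    have hsub := hKmin {T | ∀ x y, inner ℂ (T x) y = inner ℂ x (T y)} ?_ ?_ ?_
    · exact hsub hQK
    · intro S hS T hT a b _ _ _ x y
      simp only [add_apply, smul_apply, inner_add_left,
        inner_add_right, ← Complex.coe_smul (E := F), inner_smul_left, inner_smul_right,
        Complex.conj_ofReal, hS x y, hT x y]
    · simp only [Set.ofPred_forall]
      exact isClosed_iInter fun x => isClosed_iInter fun y =>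
        isClosed_eq (by fun_prop) (by fun_prop)
    · exact fun g _ => isSymmetric_rankOne_self g
  have hQN : ∀ x, Q x ∈ N := by
    have hsub := hKmin {T | ∀ x, T x ∈ N} ?_ ?_ ?_
    · exact hsub hQK
    · intro S hS T hT a b _ _ _ x
      exact N.add_mem ((N.restrictScalars ℝ).smul_mem a (hS x))
        ((N.restrictScalars ℝ).smul_mem b (hT x))
    · simp only [Set.ofPred_forall]
      exact isClosed_iInter fun x => hN.preimage (by fun_prop)
    · exact fun g hg x => N.smul_mem _ hg.2.2
  -- The trace is not norm-continuous, so a finite `r/2`-net of `Y` replaces it. Some net point `h`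
  -- near `g` has `|⟨g, h⟩| ≥ r² - r · r/2`, which bounds the functional below on each `R g`.
  have hQ0 : Q ≠ 0 := by
    obtain ⟨s, -, hs, hcov⟩ := hY.finite_cover_balls (half_pos hrpos)
    have hsub := hKmin {T | (r ^ 2 / 2) ^ 2 ≤ (∑ g ∈ hs.toFinset, inner ℂ g (T g)).re} ?_ ?_ ?_
    · rintro rfl
      have h : (r ^ 2 / 2) ^ 2 ≤ (∑ g ∈ hs.toFinset, inner ℂ g ((0 : F →L[ℂ] F) g)).re := hsub hQK
      have : 0 < (r ^ 2 / 2) ^ 2 := by positivity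
      simp at h
      linarith
    · intro S hS T hT a b ha hb hab
      simp only [Set.mem_ofPred_eq, Complex.re_sum] at hS hT ⊢
      simp only [add_apply, smul_apply, inner_add_right,
        ← Complex.coe_smul (E := F), inner_smul_right, Complex.add_re, Complex.re_ofReal_mul,
        Finset.sum_add_distrib, ← Finset.mul_sum]
      nlinarith [mul_le_mul_of_nonneg_left hS ha, mul_le_mul_of_nonneg_left hT hb]
    · exact isClosed_le (by fun_prop) (by fun_prop)
    · rintro g ⟨hgX, hgr, hgN⟩
      have hterm : ∀ h : F, (inner ℂ h (R g h)).re = ‖inner ℂ g h‖ ^ 2 := fun h => by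
        simp only [R, rankOne_apply, inner_smul_right]
        rw [← inner_conj_symm h g, Complex.mul_conj, Complex.ofReal_re, Complex.normSq_eq_norm_sq]
      obtain ⟨h, hhs, hh⟩ : ∃ h ∈ s, dist g h < r / 2 := by
        simpa using hcov (show g ∈ Y from ⟨hgX, hgr, hgN⟩)
      simp only [Set.mem_ofPred_eq, Complex.re_sum, hterm]
      refine le_trans ?_ (Finset.single_le_sum (f := fun h => ‖inner ℂ g h‖ ^ 2)
        (fun _ _ => by positivity) (hs.mem_toFinset.2 hhs))
      refine pow_le_pow_left₀ (by positivity) ?_ 2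
      have h1 : inner ℂ g h = inner ℂ g g - inner ℂ g (g - h) := by
        rw [inner_sub_right]; ring
      have h2 : ‖inner ℂ g (g - h)‖ ≤ r * (r / 2) :=
        (norm_inner_le_norm _ _).trans (by
          rw [hgr, ← dist_eq_norm]; exact mul_le_mul_of_nonneg_left hh.le hrpos.le)
      have h3 : ‖inner ℂ g g‖ = r ^ 2 := by
        rw [inner_self_eq_norm_sq_to_K, hgr]; simp
      have h4 := norm_sub_norm_le (inner ℂ g g) (inner ℂ g (g - h))
      rw [h1]
      nlinarith
  obtain ⟨z, hz, hz0⟩ : ∃ z, Module.End.HasEigenvalue (Q : Module.End ℂ F) z ∧ z ≠ 0 := by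
    by_contra! h
    exact hQ0 ((ContinuousLinearMap.eq_zero_of_forall_hasEigenvalue_eq_zero hQcomp hQsymm).1 h)
  -- For `z ≠ 0` this eigenspace of a compact operator is finite-dimensional, and `H` preserves it,
  -- so `H` has an eigenvector there.
  let W := Module.End.eigenspace (Q : Module.End ℂ F) z
  have : FiniteDimensional ℂ W :=
    ContinuousLinearMap.finite_dimensional_eigenspace hQcomp z hz0
  have : Nontrivial W := Submodule.nontrivial_iff_ne_bot.2 hz
  have hHW : ∀ w ∈ W, (H : Module.End ℂ F) w ∈ W := fun w hw => by
    rw [Module.End.mem_eigenspace_iff] at hw ⊢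
    simp only [ContinuousLinearMap.coe_coe] at hw ⊢
    rw [← hcomm, hw, map_smul]
  obtain ⟨c, hc⟩ := Module.End.exists_eigenvalue ((H : Module.End ℂ F).restrict hHW)
  obtain ⟨w, hw⟩ := hc.exists_hasEigenvector
  have hQw : Q (w : F) = z • (w : F) := Module.End.mem_eigenspace_iff.1 w.2
  refine ⟨w, ?_, fun h => hw.2 (Subtype.ext h), c, ?_⟩
  · have : (w : F) = z⁻¹ • Q w := by rw [hQw, inv_smul_smul₀ hz0]
    rw [this]
    exact N.smul_mem _ (hQN _)
  · exact congrArg Subtype.val (Module.End.mem_eigenspace_iff.1 hw.1)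

end Hilbert

/-! ### The operator on the lattice and compact boxes -/

section Lattice

theorem inner_delta_left (n : ℤ) (x : HilbertZ) : inner ℂ (delta n) x = x n := by
  rw [delta, lp.inner_single_left]; simp

theorem hasSum_smul_delta (x : HilbertZ) : HasSum (fun n => x n • delta n) x := by
  have := lp.hasSum_single (p := 2) ENNReal.ofNat_ne_top x
  refine this.congr_fun fun n => ?_
  rw [delta, ← lp.single_smul, smul_eq_mul, mul_one]

theorem norm_delta (n : ℤ) : ‖delta n‖ = 1 := by
  rw [delta, lp.norm_single (by norm_num)]; simp

theorem shift_apply (k : ℤ) (x : HilbertZ) (n : ℤ) : shift k x n = x (n + k) := rfl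

theorem delta_apply (m n : ℤ) : delta m n = if n = m then 1 else 0 := by
  rw [delta, lp.single_apply, Pi.single_apply]

theorem inner_shift_left (k : ℤ) (x y : HilbertZ) :
    inner ℂ (shift k x) y = inner ℂ x (shift (-k) y) := by
  rw [lp.inner_eq_tsum, lp.inner_eq_tsum,
    ← (Equiv.addRight k).tsum_eq (fun n => inner ℂ (x n) (shift (-k) y n))]
  simp [shift_apply]

theorem inner_mulOp_left (V : ℓ^∞(ℤ, ℝ)) (x y : HilbertZ) :
    inner ℂ (mulOp V x) y = inner ℂ x (mulOp V y) := by
  rw [lp.inner_eq_tsum, lp.inner_eq_tsum]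
  refine tsum_congr fun n => ?_
  have h : ∀ z : HilbertZ, mulOp V z n = (V n : ℂ) * z n := fun _ => rfl
  simp [h]
  ring

theorem isSymmetric_schrodingerOp (V : ℓ^∞(ℤ, ℝ)) : (schrodingerOp V).IsSymmetric := by
  intro x y
  simp only [schrodingerOp, ContinuousLinearMap.coe_coe, add_apply, inner_add_left,
    inner_add_right, inner_shift_left, inner_mulOp_left, neg_neg]
  ring

theorem schrodingerOp_delta (V : ℓ^∞(ℤ, ℝ)) (n : ℤ) :
    schrodingerOp V (delta n) = delta (n + 1) + delta (n - 1) + (V n : ℂ) • delta n := by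
  ext m
  simp only [schrodingerOp_apply, lp.coeFn_add, lp.coeFn_smul, Pi.add_apply, Pi.smul_apply,
    smul_eq_mul, delta_apply]
  have h1 : m + 1 = n ↔ m = n - 1 := by omega
  have h2 : m - 1 = n ↔ m = n + 1 := by omega
  simp only [h1, h2]
  by_cases h : m = n
  · subst h; simp
  · simp [h, add_comm]

/-- A closed subspace invariant under `H` that contains two neighbouring unit vectors is
everything. -/
theorem delta_mem_of_invariant (V : ℓ^∞(ℤ, ℝ)) (M : Submodule ℂ HilbertZ)
    (hM : ∀ x ∈ M, schrodingerOp V x ∈ M) (h0 : delta 0 ∈ M) (h1 : delta 1 ∈ M) (n : ℤ) :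
    delta n ∈ M := by
  have hup : ∀ n : ℤ, delta (n - 1) ∈ M → delta n ∈ M → delta (n + 1) ∈ M := fun n ha hb => by
    have h := M.sub_mem (M.sub_mem (hM _ hb) ha) (M.smul_mem (V n : ℂ) hb)
    rw [schrodingerOp_delta] at h
    convert h using 1
    abel
  have hdown : ∀ n : ℤ, delta (n + 1) ∈ M → delta n ∈ M → delta (n - 1) ∈ M := fun n ha hb => by
    have h := M.sub_mem (M.sub_mem (hM _ hb) ha) (M.smul_mem (V n : ℂ) hb)
    rw [schrodingerOp_delta] at h
    convert h using 1
    abel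
  have key : delta n ∈ M ∧ delta (n + 1) ∈ M := by
    induction n with
    | zero => exact ⟨h0, h1⟩
    | succ n ih =>
      refine ⟨ih.2, hup _ ?_ ih.2⟩
      simpa using ih.1
    | pred n ih =>
      refine ⟨hdown _ ih.2 ih.1, ?_⟩
      simpa using ih.1
  exact key.1

/-- The eigenvalue equation is a second-order recurrence, solvable in both directions from two
neighbouring values. -/
theorem eq_zero_of_eigen_of_apply_eq_zero (V : ℓ^∞(ℤ, ℝ)) (z : ℂ) (u : HilbertZ)
    (hu : schrodingerOp V u = z • u) (h0 : u 0 = 0) (h1 : u 1 = 0) : u = 0 := by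
  have hrec : ∀ n : ℤ, u (n + 1) + u (n - 1) + (V n : ℂ) * u n = z * u n := fun n => by
    rw [← schrodingerOp_apply, hu]; rfl
  ext n
  have key : u n = 0 ∧ u (n + 1) = 0 := by
    induction n with
    | zero => exact ⟨h0, h1⟩
    | succ n ih =>
      refine ⟨ih.2, ?_⟩
      have := hrec (n + 1)
      simpa [ih.1, ih.2] using this
    | pred n ih =>
      have := hrec (-(n : ℤ))
      refine ⟨?_, by simpa using ih.1⟩
      simpa [ih.1, ih.2] using this
  exact key.1

/-- Sequences dominated by a fixed summable sequence form a compact subset of `ℓ²(ℤ)`. -/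
theorem isCompact_box {b : ℤ → ℝ} (hb : Summable b) :
    IsCompact {x : HilbertZ | ∀ m, ‖x m‖ ≤ b m} := by
  let S : Set (ℤ → ℂ) := Set.univ.pi fun m => Metric.closedBall 0 (b m)
  have hS : IsCompact S := isCompact_univ_pi fun m => isCompact_closedBall 0 (b m)
  -- By the Weierstrass test the synthesis map is continuous on a product of discs, which is compact
  -- by Tychonoff; the box is a closed subset of its image.
  have hcont : ContinuousOn (fun c : ℤ → ℂ => ∑' m, c m • delta m) S := by
    refine continuousOn_tsum (fun m => by fun_prop) hb fun m c hc => ?_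
    rw [norm_smul, norm_delta, mul_one]
    simpa using hc m trivial
  have hclosed : IsClosed {x : HilbertZ | ∀ m, ‖x m‖ ≤ b m} := by
    simp only [Set.ofPred_forall]
    refine isClosed_iInter fun m => isClosed_le ?_ continuous_const
    simp_rw [← inner_delta_left]
    fun_prop
  refine (hS.image_of_continuousOn hcont).of_isClosed_subset hclosed fun x hx => ?_
  exact ⟨x, fun m _ => by simpa using hx m, (hasSum_smul_delta x).tsum_eq⟩

theorem convex_box (b : ℤ → ℝ) : Convex ℝ {x : HilbertZ | ∀ m, ‖x m‖ ≤ b m} := by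
  intro x hx y hy s t hs ht hst m
  have h : (s • x + t • y) m = (s : ℂ) * x m + (t : ℂ) * y m := rfl
  rw [h]
  refine (norm_add_le _ _).trans ?_
  rw [norm_mul, norm_mul, Complex.norm_real, Complex.norm_real, Real.norm_of_nonneg hs,
    Real.norm_of_nonneg ht]
  calc s * ‖x m‖ + t * ‖y m‖ ≤ s * b m + t * b m :=
        add_le_add (mul_le_mul_of_nonneg_left (hx m) hs) (mul_le_mul_of_nonneg_left (hy m) ht)
    _ = b m := by rw [← add_mul, hst, one_mul]

theorem hasDerivAt_propagator (A : HilbertZ →L[ℂ] HilbertZ) (x : HilbertZ) (t : ℝ) :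
    HasDerivAt (fun t => propagator A t x) (-(Complex.I • A (propagator A t x))) t := by
  have h : ∀ t : ℝ, propagator A t = NormedSpace.exp (t • (-(Complex.I • A))) := fun t => by
    rw [propagator]
    congr 1
    rw [RCLike.real_smul_eq_coe_smul (K := ℂ)]
    simp [smul_smul, mul_comm]
  have h1 := hasDerivAt_exp_smul_const' (𝕂 := ℝ) (-(Complex.I • A)) t
  have h2 := ((ContinuousLinearMap.apply ℂ HilbertZ x).restrictScalars ℝ).hasFDerivAt.comp_hasDerivAt
    t h1
  simp_rw [h]
  exact h2.congr_deriv rfl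

theorem propagator_zero (A : HilbertZ →L[ℂ] HilbertZ) : propagator A 0 = 1 := by
  simp [propagator]

instance separableSpace_hilbertZ : TopologicalSpace.SeparableSpace HilbertZ := by
  rw [← TopologicalSpace.isSeparable_univ_iff]
  have h : TopologicalSpace.IsSeparable (Submodule.span ℂ (Set.range delta) : Set HilbertZ) :=
    (Set.countable_range delta).isSeparable.span
  refine h.closure.mono fun x _ => ?_
  refine mem_closure_of_tendsto (hasSum_smul_delta x) (Eventually.of_forall fun s => ?_)
  exact Submodule.sum_mem _ fun n _ => Submodule.smul_mem _ _ (Submodule.subset_span ⟨n, rfl⟩)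

end Lattice

/-! ### Spectral consequences of a uniform propagator bound -/

section Deterministic

/-- A dense span of eigenvectors yields pure point spectrum. -/
theorem hasPurePointSpectrum_of_dense_span (A : HilbertZ →L[ℂ] HilbertZ) (hA : A.IsSymmetric)
    (h : Dense (Submodule.span ℂ {v : HilbertZ | v ≠ 0 ∧ ∃ z : ℂ, A v = z • v} : Set HilbertZ)) :
    HasPurePointSpectrum A := by
  set S : Set HilbertZ := {v | v ≠ 0 ∧ ∃ z : ℂ, A v = z • v} with hS
  obtain ⟨c, hcS, hcc, hSc⟩ :=
    (TopologicalSpace.IsSeparable.of_separableSpace S).exists_countable_dense_subset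
  have hdense : Dense (Submodule.span ℂ c : Set HilbertZ) := by
    rw [Submodule.dense_iff_topologicalClosure_eq_top, eq_top_iff] at h ⊢
    refine h.trans (Submodule.topologicalClosure_minimal _ (Submodule.span_le.2 ?_)
      (Submodule.isClosed_topologicalClosure _))
    exact hSc.trans (closure_mono Submodule.subset_span)
  have hne : c.Nonempty := by
    rw [Set.nonempty_iff_ne_empty]
    rintro rfl
    have h1 : delta 0 ∈ closure (Submodule.span ℂ (∅ : Set HilbertZ) : Set HilbertZ) :=
      hdense (delta 0)
    have h2 : delta 0 = 0 := by simpa using h1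
    have h3 := norm_delta 0
    simp [h2] at h3
  obtain ⟨ψ, hψ⟩ := hcc.exists_eq_range hne
  have hmem : ∀ k, ψ k ∈ S := fun k => hcS (hψ ▸ Set.mem_range_self k)
  choose h0 z hz using hmem
  refine ⟨fun k => (z k).re, ψ, fun k => ⟨h0 k, ?_⟩, hψ ▸ hdense⟩
  have hreal : (starRingEnd ℂ) (z k) = z k := by
    refine hA.conj_eigenvalue_eq_self (μ := z k) ?_
    exact Module.End.hasEigenvalue_of_hasEigenvector
      (x := ψ k) ⟨Module.End.mem_eigenspace_iff.2 (hz k), h0 k⟩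
  rw [Complex.conj_eq_iff_re.1 hreal, hz]

/-- If `e^{-itH}δ₀` and `e^{-itH}δ₁` are dominated by a summable sequence uniformly in time, then
`H` has pure point spectrum. -/
theorem hasPurePointSpectrum_of_propagator_bound (V : ℓ^∞(ℤ, ℝ)) {b : ℤ → ℝ} (hb : Summable b)
    (h0 : ∀ t m, ‖propagator (schrodingerOp V) t (delta 0) m‖ ≤ b m)
    (h1 : ∀ t m, ‖propagator (schrodingerOp V) t (delta 1) m‖ ≤ b m) :
    HasPurePointSpectrum (schrodingerOp V) := by
  set H := schrodingerOp V with hHdef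
  have hH : H.IsSymmetric := isSymmetric_schrodingerOp V
  have hHs : ∀ x y, inner ℂ (H x) y = inner ℂ x (H y) := hH
  refine hasPurePointSpectrum_of_dense_span H hH ?_
  set S : Set HilbertZ := {v | v ≠ 0 ∧ ∃ z : ℂ, H v = z • v} with hS
  let N : Submodule ℂ HilbertZ := (Submodule.span ℂ S)ᗮ
  have hNinv : ∀ x ∈ N, H x ∈ N := fun x hx => by
    refine (Submodule.span ℂ S).mem_orthogonal _ |>.2 fun v hv => ?_
    rw [← hHs]
    refine (Submodule.mem_orthogonal _ _).1 hx _ ?_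
    induction hv using Submodule.span_induction with
    | mem v hv =>
      obtain ⟨z, hz⟩ := hv.2
      rw [hz]
      exact Submodule.smul_mem _ _ (Submodule.subset_span hv)
    | zero => simp
    | add v w _ _ hv hw => rw [map_add]; exact Submodule.add_mem _ hv hw
    | smul a v _ hv => rw [map_smul]; exact Submodule.smul_mem _ _ hv
  have hNinv' : ∀ x ∈ Nᗮ, H x ∈ Nᗮ := fun x hx => by
    refine (Submodule.mem_orthogonal _ _).2 fun v hv => ?_
    rw [← hHs]
    exact (Submodule.mem_orthogonal _ _).1 hx _ (hNinv v hv)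
  have hNeig : ∀ v ∈ N, (∃ z : ℂ, H v = z • v) → v = 0 := fun v hv hz => by
    by_contra hv0
    have : inner ℂ v v = 0 :=
      (Submodule.mem_orthogonal _ _).1 hv v (Submodule.subset_span ⟨hv0, hz⟩)
    exact hv0 (inner_self_eq_zero.1 this)
  let P := N.starProjection
  have hPH : ∀ x, P (H x) = H (P x) := fun x => by
    have hx : x - P x ∈ Nᗮ := N.sub_starProjection_mem_orthogonal x
    have h2 : H x = H (P x) + H (x - P x) := by rw [← map_add]; simp
    rw [h2, map_add, Submodule.starProjection_eq_self_iff.2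
      (hNinv _ (N.starProjection_apply_mem x)), (N.starProjection_apply_eq_zero_iff).2 (hNinv' _ hx), add_zero]
  -- The projection `P` commutes with `H`, so the projected orbit solves the same equation in `N`;
  -- unless it is zero, it produces an eigenvector in `N`.
  have hdelta : ∀ x, (∀ t m, ‖propagator H t x m‖ ≤ b m) → x ∈ Nᗮ := fun x hx => by
    rw [← Submodule.starProjection_apply_eq_zero_iff]
    by_contra hne
    have hderiv : ∀ t, HasDerivAt (fun t => P (propagator H t x))
        (-(Complex.I • H (P (propagator H t x)))) t := fun t => by
      have := (P.restrictScalars ℝ).hasFDerivAt.comp_hasDerivAt t (hasDerivAt_propagator H x t)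
      refine this.congr_deriv ?_
      simp [hPH]
    obtain ⟨v, hvN, hv0, hv⟩ := exists_eigenvector_of_compact_orbit H hH
      (fun t => P (propagator H t x)) hderiv ((isCompact_box hb).image P.continuous)
      (fun t => ⟨_, hx t, rfl⟩) (by simpa [propagator_zero] using hne) N
      (Submodule.isClosed_orthogonal _) (fun t => N.starProjection_apply_mem _)
    exact hv0 (hNeig v hvN hv)
  rw [Submodule.dense_iff_topologicalClosure_eq_top, Submodule.topologicalClosure_eq_top_iff]
  have htop : Nᗮ = ⊤ := by
    rw [eq_top_iff]
    intro x _
    refine (Submodule.isClosed_orthogonal N).mem_of_tendsto (hasSum_smul_delta x)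
      (Eventually.of_forall fun s => Submodule.sum_mem _ fun n _ => Submodule.smul_mem _ _ ?_)
    exact delta_mem_of_invariant V Nᗮ hNinv' (hdelta _ h0) (hdelta _ h1) n
  rw [Submodule.eq_bot_iff]
  intro x hx
  have hx' : x ∈ Nᗮ := htop ▸ Submodule.mem_top
  exact inner_self_eq_zero.1 ((Submodule.mem_orthogonal _ _).1 hx' x hx)

/-- The time average of `e^{i(E-H)t}x` projects `x` onto the eigenspace of `E` and inherits the
bounds of the propagator. -/
theorem exists_eigen_projection (A : HilbertZ →L[ℂ] HilbertZ) (hA : A.IsSymmetric) (E : ℝ)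
    (x : HilbertZ) {b : ℤ → ℝ} (hb : Summable b) (hx : ∀ t m, ‖propagator A t x m‖ ≤ b m) :
    ∃ φ : HilbertZ, (∀ m, ‖φ m‖ ≤ b m) ∧ A φ = (E : ℂ) • φ ∧
      ∀ u, A u = (E : ℂ) • u → inner ℂ u φ = inner ℂ u x := by
  have hAs : ∀ x y, inner ℂ (A x) y = inner ℂ x (A y) := hA
  let L : HilbertZ →L[ℂ] HilbertZ := Complex.I • ((E : ℂ) • 1 - A)
  let G : ℝ → HilbertZ := fun t => Complex.exp (Complex.I * E * t) • propagator A t x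
  have hG : ∀ t, HasDerivAt G (L (G t)) t := fun t => by
    have h1 : HasDerivAt (fun t : ℝ => Complex.exp (Complex.I * E * t))
        (Complex.exp (Complex.I * E * t) * (Complex.I * E)) t := by
      have := ((hasDerivAt_id (t : ℂ)).const_mul (Complex.I * E)).cexp.comp_ofReal
      simpa using this
    refine (h1.smul (hasDerivAt_propagator A x t)).congr_deriv ?_
    simp only [L, G, smul_apply, sub_apply, one_apply_eq_self, map_smul]
    module
  -- The pairings of `G t` with eigenvectors for `E` are constant in time, so the orbit stays in
  -- this closed affine set.
  let Z : Set HilbertZ := {y | ∀ u, A u = (E : ℂ) • u → inner ℂ u y = inner ℂ u x}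
  have hZc : IsClosed Z := by
    simp only [Z, Set.ofPred_forall]
    exact isClosed_iInter fun u => isClosed_iInter fun _ => isClosed_eq (by fun_prop) (by fun_prop)
  have hZconv : Convex ℝ Z := by
    intro y hy w hw a c _ _ hac u hu
    have h : a • y + c • w = (a : ℂ) • y + (c : ℂ) • w := rfl
    rw [h, inner_add_right, inner_smul_right,
      inner_smul_right, hy u hu, hw u hu, ← add_mul]
    norm_cast
    rw [hac]; simp
  have hGZ : ∀ t, G t ∈ Z := fun t u hu => by
    have hd : ∀ t, HasDerivAt (fun t => inner ℂ u (G t)) 0 t := fun t => by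
      refine ((hasDerivAt_const t u).inner ℂ (hG t)).congr_deriv ?_
      simp only [inner_zero_left, add_zero, L, smul_apply, sub_apply,
        one_apply_eq_self, inner_smul_right, inner_sub_right, ← hAs, hu,
        inner_smul_left, Complex.conj_ofReal]
      ring
    have := is_const_of_deriv_eq_zero (fun t => (hd t).differentiableAt) (fun t => (hd t).deriv) t 0
    simpa [G, propagator_zero] using this
  obtain ⟨φ, ⟨hφb, hφZ⟩, hLφ⟩ := exists_mem_apply_eq_zero_of_flow L G hG
    ((isCompact_box hb).inter_right hZc) ((convex_box b).inter hZconv)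
    (fun t => ⟨fun m => by
      have h : G t m = Complex.exp (Complex.I * E * t) * propagator A t x m := rfl
      have h2 : ‖Complex.exp (Complex.I * E * t)‖ = 1 := by
        rw [Complex.norm_exp]; simp
      rw [h, norm_mul, h2, one_mul]
      exact hx t m, hGZ t⟩)
  refine ⟨φ, hφb, ?_, hφZ⟩
  have : (E : ℂ) • φ - A φ = 0 := by
    have h : Complex.I • ((E : ℂ) • φ - A φ) = 0 := hLφ
    exact (smul_eq_zero.1 h).resolve_left Complex.I_ne_zero
  exact (sub_eq_zero.1 this).symm

/-- Eigenvectors inherit the decay of `e^{-itH}δ₀` and `e^{-itH}δ₁`. -/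
theorem eigenvector_bound_of_propagator_bound (V : ℓ^∞(ℤ, ℝ)) {b : ℤ → ℝ} (hb : Summable b)
    (h0 : ∀ t m, ‖propagator (schrodingerOp V) t (delta 0) m‖ ≤ b m)
    (h1 : ∀ t m, ‖propagator (schrodingerOp V) t (delta 1) m‖ ≤ b m)
    (z : ℂ) (u : HilbertZ) (hu0 : u ≠ 0) (hu : schrodingerOp V u = z • u) :
    ∃ D : ℝ, 0 ≤ D ∧ ∀ n, ‖u n‖ ≤ D * b n := by
  have hH : (schrodingerOp V).IsSymmetric := isSymmetric_schrodingerOp V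
  obtain ⟨E, rfl⟩ : ∃ E : ℝ, (E : ℂ) = z := Complex.conj_eq_iff_real.1
    (hH.conj_eigenvalue_eq_self (μ := z) (Module.End.hasEigenvalue_of_hasEigenvector
      (x := u) ⟨Module.End.mem_eigenspace_iff.2 hu, hu0⟩)) |>.imp fun _ h => h.symm
  obtain ⟨φ₀, hb0, hφ0, hin0⟩ := exists_eigen_projection _ hH E _ hb h0
  obtain ⟨φ₁, hb1, hφ1, hin1⟩ := exists_eigen_projection _ hH E _ hb h1
  let W : Submodule ℂ HilbertZ := Submodule.span ℂ {φ₀, φ₁}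
  have : FiniteDimensional ℂ W := FiniteDimensional.span_of_finite ℂ (by simp)
  have hWeig : ∀ w ∈ W, schrodingerOp V w = (E : ℂ) • w := fun w hw => by
    obtain ⟨a, c, rfl⟩ := Submodule.mem_span_pair.1 hw
    rw [map_add, map_smul, map_smul, hφ0, hφ1]
    module
  -- The part `v` of `u` orthogonal to `W` is in the eigenspace, and `⟨v, δ_j⟩ = ⟨v, φ_j⟩ = 0` for
  -- `j = 0, 1`.
  have huW : u ∈ W := by
    have hv : u - W.starProjection u ∈ Wᗮ := W.sub_starProjection_mem_orthogonal u
    have hveig : schrodingerOp V (u - W.starProjection u) = (E : ℂ) • (u - W.starProjection u) := by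
      rw [map_sub, hu, hWeig _ (W.starProjection_apply_mem u), smul_sub]
    have hzero : ∀ n φ, φ ∈ W → inner ℂ (u - W.starProjection u) φ =
        inner ℂ (u - W.starProjection u) (delta n) → (u - W.starProjection u) n = 0 :=
      fun n φ hφ h => by
        rw [← inner_delta_left, inner_eq_zero_symm, ← h]
        exact (Submodule.mem_orthogonal' _ _).1 hv φ hφ
    have h := eq_zero_of_eigen_of_apply_eq_zero V E _ hveig
      (hzero 0 φ₀ (Submodule.subset_span (by simp)) (hin0 _ hveig))
      (hzero 1 φ₁ (Submodule.subset_span (by simp)) (hin1 _ hveig))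
    rw [sub_eq_zero.1 h]
    exact W.starProjection_apply_mem u
  obtain ⟨a, c, hac⟩ := Submodule.mem_span_pair.1 huW
  refine ⟨‖a‖ + ‖c‖, by positivity, fun n => ?_⟩
  have h : u n = a * φ₀ n + c * φ₁ n := by rw [← hac]; rfl
  rw [h, add_mul]
  refine (norm_add_le _ _).trans (add_le_add ?_ ?_)
  · rw [norm_mul]; exact mul_le_mul_of_nonneg_left (hb0 n) (norm_nonneg _)
  · rw [norm_mul]; exact mul_le_mul_of_nonneg_left (hb1 n) (norm_nonneg _)

end Deterministic

/-! ### Measurability and almost sure bounds -/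

section Random

variable {ν : Measure ℝ} (hν : IsCompact ν.support)

theorem measurable_randomOp_pow_apply (n : ℤ) (k : ℕ) :
    ∀ m : ℤ, Measurable fun ω : Sample ν => ((randomOp hν ω ^ k) (delta n) : HilbertZ) m := by
  induction k with
  | zero => intro m; simp
  | succ k ih =>
    intro m
    have h : ∀ ω : Sample ν, ((randomOp hν ω ^ (k + 1)) (delta n) : HilbertZ) m =
        (randomOp hν ω ^ k) (delta n) (m + 1) + (randomOp hν ω ^ k) (delta n) (m - 1)
          + ((ω m : ℝ) : ℂ) * (randomOp hν ω ^ k) (delta n) m := fun ω => by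
      rw [pow_succ']
      exact schrodingerOp_apply _ _ _
    simp_rw [h]
    have key : ∀ f g h : Sample ν → ℂ, Measurable f → Measurable g → Measurable h →
        Measurable fun ω => f ω + g ω + ((ω m : ℝ) : ℂ) * h ω := fun f g h hf hg hh =>
      (hf.add hg).add (Measurable.mul (Complex.measurable_ofReal.comp
        (measurable_subtype_coe.comp (measurable_pi_apply m))) hh)
    exact key _ _ _ (ih _) (ih _) (ih _)

theorem measurable_propagator_apply (t : ℝ) (m n : ℤ) :
    Measurable fun ω : Sample ν => propagator (randomOp hν ω) t (delta n) m := by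
  set c : ℂ := -(Complex.I * (t : ℂ)) with hc
  have hsum : ∀ ω : Sample ν, HasSum (fun k : ℕ => ((k.factorial : ℂ)⁻¹ * c ^ k) *
      ((randomOp hν ω ^ k) (delta n) : HilbertZ) m)
      (propagator (randomOp hν ω) t (delta n) m) := fun ω => by
    have h1 := NormedSpace.exp_series_hasSum_exp' (𝕂 := ℂ) (c • randomOp hν ω)
    have h2 := h1.mapL (innerSL ℂ (delta m) ∘L ContinuousLinearMap.apply ℂ HilbertZ (delta n))
    have h3 : ∀ B : HilbertZ →L[ℂ] HilbertZ,
        (innerSL ℂ (delta m) ∘L ContinuousLinearMap.apply ℂ HilbertZ (delta n)) B = B (delta n) m :=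
      fun B => inner_delta_left m _
    simp only [h3] at h2
    refine h2.congr_fun fun k => ?_
    rw [smul_pow, smul_smul]
    rfl
  refine measurable_of_tendsto_metrizable (f := fun N ω => ∑ k ∈ Finset.range N,
    ((k.factorial : ℂ)⁻¹ * c ^ k) * ((randomOp hν ω ^ k) (delta n) : HilbertZ) m) (fun N => ?_)
    (tendsto_pi_nhds.2 fun ω => (hsum ω).tendsto_sum_nat)
  exact Finset.measurable_sum _ fun k _ => (measurable_randomOp_pow_apply hν n k m).const_mul _

/-- Continuity and density make the supremum over time countable, hence measurable in `ω`. -/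
theorem iSup_real_eq_iSup_rat {g : ℝ → ℝ≥0∞} (hg : Continuous g) :
    ⨆ t, g t = ⨆ q : ℚ, g q := by
  refine le_antisymm (iSup_le fun t => ?_) (iSup_le fun q => le_iSup g q)
  exact Rat.denseRange_cast.induction_on (p := fun t => g t ≤ ⨆ q : ℚ, g q) t
    (isClosed_le hg continuous_const) fun q => le_iSup (fun q : ℚ => g q) q

theorem measurable_iSup_propagator (m n : ℤ) :
    Measurable fun ω : Sample ν =>
      ⨆ t : ℝ, ‖inner ℂ (delta m) (propagator (randomOp hν ω) t (delta n))‖ₑ := by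
  have h : ∀ ω : Sample ν, ⨆ t : ℝ, ‖inner ℂ (delta m) (propagator (randomOp hν ω) t (delta n))‖ₑ =
      ⨆ q : ℚ, ‖propagator (randomOp hν ω) q (delta n) m‖ₑ := fun ω => by
    have hcont : Continuous fun t => propagator (randomOp hν ω) t (delta n) :=
      continuous_iff_continuousAt.2 fun t => (hasDerivAt_propagator _ _ t).continuousAt
    rw [iSup_real_eq_iSup_rat (by fun_prop)]
    simp_rw [inner_delta_left]
  simp_rw [h]
  exact Measurable.iSup fun q => (measurable_propagator_apply hν q m n).enorm

theorem summable_exp_neg_mul_abs {κ : ℝ} (hκ : 0 < κ) :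
    Summable fun m : ℤ => Real.exp (-κ * |(m : ℝ)|) := by
  have h : Summable fun n : ℕ => Real.exp (-κ * |((n : ℤ) : ℝ)|) := by
    have := Real.summable_exp_nat_mul_iff.2 (neg_lt_zero.2 hκ)
    refine this.congr fun n => ?_
    simp [mul_comm]
  exact Summable.of_nat_of_neg h (by simpa using h)

/-- Exponential decay of `a(m, n)` in `m` gives almost surely an exponential bound on
`e^{-itH}δ_n` with an arbitrarily small loss in the rate. -/
theorem ae_propagator_bound [IsProbabilityMeasure ν] {C γ : ℝ} (n : ℤ)
    (hdyn : ∀ m : ℤ, dynAmplitude hν m n ≤ ENNReal.ofReal (C * Real.exp (-γ * |(m : ℝ)|)))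
    {ε : ℝ} (hε : 0 < ε) :
    ∀ᵐ ω ∂(sampleMeasure ν), ∃ D : ℝ, 0 ≤ D ∧ ∀ t m,
      ‖propagator (randomOp hν ω) t (delta n) m‖ ≤ D * Real.exp (-(γ - ε) * |(m : ℝ)|) := by
  let s : ℤ → Sample ν → ℝ≥0∞ := fun m ω =>
    ⨆ t : ℝ, ‖inner ℂ (delta m) (propagator (randomOp hν ω) t (delta n))‖ₑ
  have hs : ∀ m, Measurable (s m) := fun m => measurable_iSup_propagator hν m n
  -- With this weight the hypothesis leaves the summable bound `C e^{-ε|m|}` for the expectation of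
  -- each term.
  let w : ℤ → ℝ≥0∞ := fun m => ENNReal.ofReal (Real.exp ((γ - ε) * |(m : ℝ)|))
  have hfin : ∫⁻ ω, ∑' m, w m * s m ω ∂(sampleMeasure ν) ≠ ∞ := by
    rw [lintegral_tsum fun m => ((hs m).const_mul _).aemeasurable]
    have hle : ∀ m, ∫⁻ ω, w m * s m ω ∂(sampleMeasure ν) ≤
        ENNReal.ofReal (C * Real.exp (-ε * |(m : ℝ)|)) := fun m => by
      rw [lintegral_const_mul _ (hs m)]
      refine (mul_le_mul_right (hdyn m) _).trans_eq ?_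
      rw [← ENNReal.ofReal_mul (Real.exp_pos _).le, mul_left_comm, ← Real.exp_add]
      ring_nf
    refine ne_top_of_le_ne_top ?_ (ENNReal.tsum_le_tsum hle)
    exact ((summable_exp_neg_mul_abs hε).mul_left C).tsum_ofReal_ne_top
  filter_upwards [ae_lt_top (Measurable.tsum fun m => (hs m).const_mul _) hfin] with ω hω
  refine ⟨(∑' m, w m * s m ω).toReal, ENNReal.toReal_nonneg, fun t m => ?_⟩
  have h1 : w m * ‖propagator (randomOp hν ω) t (delta n) m‖ₑ ≤ ∑' m, w m * s m ω := by
    refine le_trans (mul_le_mul_right ?_ _) (ENNReal.le_tsum m)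
    rw [← inner_delta_left]
    exact le_iSup (fun t : ℝ => ‖inner ℂ (delta m) (propagator (randomOp hν ω) t (delta n))‖ₑ) t
  have h2 := ENNReal.toReal_mono hω.ne h1
  rw [ENNReal.toReal_mul, ENNReal.toReal_ofReal (Real.exp_pos _).le, toReal_enorm] at h2
  rw [neg_mul, Real.exp_neg, ← div_eq_mul_inv, le_div_iff₀ (Real.exp_pos _), mul_comm]
  exact h2

end Random

end RandomSchrodinger

open RandomSchrodinger

theorem mainTheorem7 (ν : MeasureTheory.Measure ℝ) [MeasureTheory.IsProbabilityMeasure ν]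
    (hν : IsCompact ν.support) (C γ : ℝ) (hC : 0 < C) (hγ : 0 < γ)
    (hdyn : ∀ m : ℤ,
      max (RandomSchrodinger.dynAmplitude hν m 0) (RandomSchrodinger.dynAmplitude hν m 1)
        ≤ ENNReal.ofReal (C * Real.exp (-γ * |(m : ℝ)|))) :
    ∀ᵐ ω ∂(RandomSchrodinger.sampleMeasure ν),
      RandomSchrodinger.HasPurePointSpectrum (RandomSchrodinger.randomOp hν ω) ∧
      ∀ ε : ℝ, 0 < ε → ∀ (E : ℂ) (u : RandomSchrodinger.HilbertZ),
        u ≠ 0 → RandomSchrodinger.randomOp hν ω u = E • u →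
        ∃ D : ℝ, 0 < D ∧ ∀ n : ℤ, ‖u n‖ ≤ D * Real.exp (-(γ - ε) * |(n : ℝ)|) := by
  -- Countably many losses give one null set for all `ε`. The shift by `2` keeps the rate `γ - γ /
  -- (k + 2)` positive even at `k = 0`, so the bounds are summable.
  have hε : ∀ k : ℕ, 0 < γ / (k + 2) := fun k => by positivity
  have hae : ∀ k : ℕ, ∀ᵐ ω ∂(sampleMeasure ν), ∃ b : ℤ → ℝ, Summable b ∧
      (∃ D : ℝ, 0 ≤ D ∧ ∀ m : ℤ, b m ≤ D * Real.exp (-(γ - γ / (k + 2)) * |(m : ℝ)|)) ∧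
      (∀ t m, ‖propagator (randomOp hν ω) t (delta 0) m‖ ≤ b m) ∧
      ∀ t m, ‖propagator (randomOp hν ω) t (delta 1) m‖ ≤ b m := fun k => by
    filter_upwards [ae_propagator_bound hν 0 (fun m => (le_max_left _ _).trans (hdyn m)) (hε k),
      ae_propagator_bound hν 1 (fun m => (le_max_right _ _).trans (hdyn m)) (hε k)]
      with ω ⟨D₀, hD₀, h₀⟩ ⟨D₁, hD₁, h₁⟩
    have hκ : 0 < γ - γ / (k + 2) := by
      rw [sub_pos, div_lt_iff₀ (by positivity)]
      nlinarith [(k.cast_nonneg : (0 : ℝ) ≤ k)]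
    refine ⟨fun m => (D₀ + D₁) * Real.exp (-(γ - γ / (k + 2)) * |(m : ℝ)|),
      (summable_exp_neg_mul_abs hκ).mul_left _, ⟨D₀ + D₁, by positivity, fun _ => le_rfl⟩,
      fun t m => (h₀ t m).trans ?_, fun t m => (h₁ t m).trans ?_⟩ <;>
    · refine mul_le_mul_of_nonneg_right ?_ (Real.exp_pos _).le
      linarith
  filter_upwards [ae_all_iff.2 hae] with ω hω
  refine ⟨?_, fun ε hε' E u hu0 hu => ?_⟩
  · obtain ⟨b, hb, -, h₀, h₁⟩ := hω 0
    exact hasPurePointSpectrum_of_propagator_bound _ hb h₀ h₁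
  · obtain ⟨k, hk⟩ := exists_nat_gt (γ / ε)
    obtain ⟨b, hb, ⟨D, hD, hbD⟩, h₀, h₁⟩ := hω k
    obtain ⟨D', hD', hu'⟩ := eigenvector_bound_of_propagator_bound _ hb h₀ h₁ E u hu0 hu
    have hkε : γ / (k + 2) ≤ ε := by
      rw [div_lt_iff₀ hε'] at hk
      rw [div_le_iff₀ (by positivity)]
      nlinarith
    -- The `+ 1` makes the constant strictly positive, as `D' * D` is only known to be nonnegative.
    refine ⟨D' * D + 1, by positivity, fun n => (hu' n).trans ?_⟩
    calc D' * b n ≤ D' * (D * Real.exp (-(γ - γ / (k + 2)) * |(n : ℝ)|)) :=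
          mul_le_mul_of_nonneg_left (hbD n) hD'
      _ = D' * D * Real.exp (-(γ - γ / (k + 2)) * |(n : ℝ)|) := (mul_assoc _ _ _).symm
      _ ≤ (D' * D + 1) * Real.exp (-(γ - ε) * |(n : ℝ)|) := by
          refine mul_le_mul (by linarith) (Real.exp_le_exp.2 ?_) (Real.exp_pos _).le (by positivity)
          exact mul_le_mul_of_nonneg_right (by linarith) (abs_nonneg _)
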